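/- All semirings are commutative with $0$ and $1$, and semiring homomorphisms preserve $+$, $\cdot$, $0$ and $1$. A \emph{preordered semiring} is a semiring $S$ with a preorder $\le$ such that $x \le y$ implies $a + x \le a + y$ and $ax \le ay$ for all $a, x, y \in S$. It is a \emph{preordered $\mathbb{Q}_+$-semialgebra} if moreover it is a semialgebra over the semiring $\mathbb{Q}_+$ of nonnegative rationals, i.e.\ equipped with a semiring homomorphism $\mathbb{Q}_+ \to S$. An element $u \in S$ is \emph{power universal} if $u \ge 1$ and for all nonzero $x, y \in S$ with $x \le y$ there is $k \in \mathbb{N}$ with $y \le u^k x$. Write $\mathbb{R}_+ = [0,\infty)$ with its usual order. \textbf{Theorem.} Let $S$ be a preordered $\mathbb{Q}_+$-semialgebra with power universal $u \in S$ and $1 \ge 0$. Then for nonzero $x, y \in S$, the following are equivalent: \begin{enumerate} \item $\phi(x) \le \phi(y)$ for all monotone semiring homomorphisms $\phi : S \to \mathbb{R}_+$. \item For every $r \in \mathbb{R}_+$ and $\varepsilon > 0$, there exist a polynomial $p \in \mathbb{Q}_+[X]$ and nonzero $a \in S$ such that $p(r) \le \varepsilon$ and \[ a x \le a\,(y + p(u)).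 \] \item For every $r \in \mathbb{R}_+$ and $\varepsilon > 0$, there exist a polynomial $p \in \mathbb{Q}_+[X]$ and nonzero $a \in S$ such that $p(r) \le 1 + \varepsilon$ and \[ a x \le p(u)\, a y. \] \item For every $r \in \mathbb{R}_+$ and $\varepsilon > 0$, there exist a polynomial $p \in \mathbb{Q}_+[X]$ and an integer $n \ge 1$ such that $p(r) \le (1 + \varepsilon)^n$ and \[ x^n \le p(u)\, y^n. \] \end{enumerate} -/

import Mathlib

open Polynomial
open scoped NNReal

/-- A commutative semiring with a preorder is a *preordered semiring* if addition and
multiplication by an arbitrary element are monotone. -/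
class IsPreorderedSemiring (S : Type*) [CommSemiring S] [Preorder S] : Prop where
  add_le_add : ∀ a x y : S, x ≤ y → a + x ≤ a + y
  mul_le_mul : ∀ a x y : S, x ≤ y → a * x ≤ a * y

/-- `u` is *power universal* if `u ≥ 1` and for all nonzero `x ≤ y` there is `k : ℕ` with
`y ≤ u ^ k * x`. -/
def IsPowerUniversal {S : Type*} [CommSemiring S] [Preorder S] (u : S) : Prop :=
  1 ≤ u ∧ ∀ x y : S, x ≠ 0 → y ≠ 0 → x ≤ y → ∃ k : ℕ, y ≤ u ^ k * x

/-! If `1 ≤ 0`, any two elements are comparable both ways and all four conditions hold. Otherwise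
the substance is 1 → 2. For fixed `r`, condition 2 says `Relaxed u r x y`. This relation is a
cancellative semiring preorder, and a geometric sum used as catalyst places `u` below every natural
number exceeding `r`; hence all elements become bounded (`relaxed_natCast`, `relaxed_cancellative`).

In a bounded cancellative preorder where `x ≤ y` fails, one may impose `y ≤ x`, extend to a total
preorder by Zorn, and read off real values by Dedekind cuts (`exists_hom`). The result is a monotone
`φ` with `φ y ≤ φ x`; with `y + d`, `d > 0` rational, in place of `y`, this contradicts condition 1.

The rest is direct: 2 → 3 makes the error multiplicative via `1 ≤ u ^ k * y`, 3 → 4 iterates and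
removes the catalyst at bounded cost, 4 → 1 applies `φ` and takes roots. -/

open Set Filter Topology

/-- A relation on a commutative semiring which is a semiring preorder with nonnegative elements,
bounded above by natural numbers, with nonzero elements bounded away from zero, and in which
no element dominates its own successor. -/
structure IsBoundedSemiringPreorder {S : Type*} [CommSemiring S] (r : S → S → Prop) : Prop where
  refl : ∀ s, r s s
  trans : ∀ {s t v}, r s t → r t v → r s v
  add : ∀ a {s t}, r s t → r (a + s) (a + t)
  mul : ∀ a {s t}, r s t → r (a * s) (a * t)
  nonneg : ∀ s, r 0 s
  le_nat : ∀ s, ∃ n : ℕ, r s n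
  one_le_nat_mul : ∀ s, s ≠ 0 → ∃ n : ℕ, r 1 (n * s)
  not_succ_le : ∀ c, ¬ r (c + 1) c

/-! ### Extension to total preorders -/

namespace IsBoundedSemiringPreorder

variable {S : Type*} [CommSemiring S] {r : S → S → Prop}

/-- Multiplicative and additive cancellation for a relation. -/
def Cancellative (r : S → S → Prop) : Prop :=
  ∀ c e s t : S, c ≠ 0 → r (c * s + e) (c * t + e) → r s t

theorem add_add (h : IsBoundedSemiringPreorder r) {s t s' t' : S} (h₁ : r s t) (h₂ : r s' t') :
    r (s + s') (t + t') := by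
  refine h.trans (h.add s h₂) ?_
  rw [add_comm s, add_comm t]
  exact h.add t' h₁

theorem mul_mul (h : IsBoundedSemiringPreorder r) {s t s' t' : S} (h₁ : r s t) (h₂ : r s' t') :
    r (s * s') (t * t') := by
  refine h.trans (h.mul s h₂) ?_
  rw [mul_comm s, mul_comm t]
  exact h.mul t' h₁

/-- The relation obtained by forcing `y` to be below `x`. -/
theorem adjoin [NoZeroDivisors S] (h : IsBoundedSemiringPreorder r) (hc : Cancellative r)
    {x y : S} (hxy : ¬ r x y) :
    IsBoundedSemiringPreorder (fun s t => ∃ z, r (s + z * x) (t + z * y)) where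
  refl s := ⟨0, by simpa using h.refl s⟩
  trans := by
    rintro s t v ⟨z, hz⟩ ⟨w, hw⟩
    refine ⟨z + w, ?_⟩
    have h₁ := h.add (w * x) hz
    have h₂ := h.add (z * y) hw
    refine h.trans (t := w * x + (t + z * y)) ?_ ?_
    · convert h₁ using 1; ring
    · convert h₂ using 1 <;> ring
  add := by
    rintro a s t ⟨z, hz⟩
    exact ⟨z, by simpa only [add_assoc] using h.add a hz⟩
  mul := by
    rintro a s t ⟨z, hz⟩
    exact ⟨a * z, by simpa only [mul_add, mul_assoc] using h.mul a hz⟩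
  nonneg s := ⟨0, by simpa using h.nonneg s⟩
  le_nat s := (h.le_nat s).imp fun n hn => ⟨0, by simpa using hn⟩
  one_le_nat_mul s hs := (h.one_le_nat_mul s hs).imp fun n hn => ⟨0, by simpa using hn⟩
  not_succ_le := by
    rintro c ⟨z, hz⟩
    by_cases hz0 : z = 0
    · subst hz0
      exact h.not_succ_le c (by simpa using hz)
    -- Since `c + 1 + z * x ≤ c + z * y ≤ c + 1 + z * y`, cancelling `c + 1` and `z` would give `x ≤
    -- y`.
    · refine hxy (hc z (c + 1) x y hz0 (h.trans ?_ (h.trans hz ?_)))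
      · rw [add_comm]; exact h.refl _
      · have := h.add (c + z * y) (h.nonneg 1)
        convert this using 1 <;> ring

/-- The cancellative closure of a bounded semiring preorder. -/
theorem cancel [NoZeroDivisors S] [Nontrivial S] (h : IsBoundedSemiringPreorder r) :
    IsBoundedSemiringPreorder
      (fun s t => ∃ c e, c ≠ 0 ∧ r (c * s + e) (c * t + e)) := by
  have emb : ∀ {s t}, r s t → ∃ c e, c ≠ 0 ∧ r (c * s + e) (c * t + e) :=
    fun {s t} hst => ⟨1, 0, one_ne_zero, by simpa using hst⟩
  refine ⟨fun s => emb (h.refl s), ?_, ?_, ?_, fun s => emb (h.nonneg s),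
    fun s => (h.le_nat s).imp fun n hn => emb hn,
    fun s hs => (h.one_le_nat_mul s hs).imp fun n hn => emb hn, ?_⟩
  · rintro s t v ⟨c, e, hc, h₁⟩ ⟨d, f, hd, h₂⟩
    refine ⟨c * d, d * e + c * f, mul_ne_zero hc hd, ?_⟩
    have h₁' := h.add (c * f) (h.mul d h₁)
    have h₂' := h.add (d * e) (h.mul c h₂)
    refine h.trans (t := c * d * t + (d * e + c * f)) ?_ ?_
    · convert h₁' using 1 <;> ring
    · convert h₂' using 1 <;> ring
  · rintro a s t ⟨c, e, hc, h₁⟩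
    refine ⟨c, e, hc, ?_⟩
    simpa only [mul_add, add_assoc] using h.add (c * a) h₁
  · rintro a s t ⟨c, e, hc, h₁⟩
    refine ⟨c, a * e, hc, ?_⟩
    convert h.mul a h₁ using 1 <;> ring
  · rintro w ⟨c, e, hc, h₁⟩
    obtain ⟨n, hn⟩ := h.one_le_nat_mul c hc
    -- With `1 ≤ n * c`, the multiplier `n` raises the gap `c` between the two sides of `h₁` to at
    -- least `1`.
    refine h.not_succ_le (n * (c * w + e)) (h.trans (h.add _ hn) ?_)
    convert h.mul (n : S) h₁ using 1; ring

/-- Every bounded semiring preorder extends to a maximal one. -/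
theorem exists_maximal (h : IsBoundedSemiringPreorder r) :
    ∃ m, r ≤ m ∧ Maximal (fun r' : S → S → Prop => IsBoundedSemiringPreorder r') m := by
  refine zorn_le_nonempty₀ {r' : S → S → Prop | IsBoundedSemiringPreorder r'} ?_ r h
  intro C hC hchain r₀ hr₀
  have h₀ := hC hr₀
  refine ⟨fun s t => ∃ r' ∈ C, r' s t, ?_, fun r' hr' s t hst => ⟨r', hr', hst⟩⟩
  refine ⟨fun s => ⟨r₀, hr₀, h₀.refl s⟩, ?_, ?_, ?_, fun s => ⟨r₀, hr₀, h₀.nonneg s⟩,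
    fun s => (h₀.le_nat s).imp fun n hn => ⟨r₀, hr₀, hn⟩,
    fun s hs => (h₀.one_le_nat_mul s hs).imp fun n hn => ⟨r₀, hr₀, hn⟩, ?_⟩
  · rintro s t v ⟨r₁, hr₁, h₁⟩ ⟨r₂, hr₂, h₂⟩
    rcases hchain.total hr₁ hr₂ with hle | hle
    · exact ⟨r₂, hr₂, (hC hr₂).trans (hle _ _ h₁) h₂⟩
    · exact ⟨r₁, hr₁, (hC hr₁).trans h₁ (hle _ _ h₂)⟩
  · rintro a s t ⟨r₁, hr₁, h₁⟩
    exact ⟨r₁, hr₁, (hC hr₁).add a h₁⟩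
  · rintro a s t ⟨r₁, hr₁, h₁⟩
    exact ⟨r₁, hr₁, (hC hr₁).mul a h₁⟩
  · rintro c ⟨r₁, hr₁, h₁⟩
    exact (hC hr₁).not_succ_le c h₁

/-- Every bounded semiring preorder extends to a total one. -/
theorem exists_total [NoZeroDivisors S] [Nontrivial S] (h : IsBoundedSemiringPreorder r) :
    ∃ m : S → S → Prop, r ≤ m ∧ IsBoundedSemiringPreorder m ∧ ∀ s t, m s t ∨ m t s := by
  obtain ⟨m, hrm, hm, hmax⟩ := h.exists_maximal
  -- A maximal relation contains its own cancellative closure; for the same reason it contains the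
  -- relation adjoining `t ≤ s` whenever `s ≤ t` fails.
  have hcanc : Cancellative m := fun c e s t hc hst =>
    hmax (IsBoundedSemiringPreorder.cancel hm)
      (fun s t hst => ⟨1, 0, one_ne_zero, by simpa using hst⟩) s t ⟨c, e, hc, hst⟩
  refine ⟨m, hrm, hm, fun s t => or_iff_not_imp_left.2 fun hst => ?_⟩
  exact hmax (hm.adjoin hcanc hst) (fun a b hab => ⟨0, by simpa using hab⟩) t s
    ⟨1, by rw [add_comm]; simpa using hm.refl _⟩

/-! ### Real values by Dedekind cuts -/

section Eval

variable [Algebra ℚ≥0 S]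

theorem le_of_algebraMap (h : IsBoundedSemiringPreorder r) {p q : ℚ≥0}
    (hpq : r (algebraMap ℚ≥0 S p) (algebraMap ℚ≥0 S q)) : p ≤ q := by
  by_contra! hlt
  obtain ⟨d, rfl⟩ := exists_add_of_le hlt.le
  have hd : d ≠ 0 := by rintro rfl; simp at hlt
  have := h.mul (algebraMap ℚ≥0 S d⁻¹) hpq
  rw [← map_mul, ← map_mul, mul_add, inv_mul_cancel₀ hd, map_add, map_one] at this
  exact h.not_succ_le _ this

/-- The real number cut out by an element of a bounded preordered semiring. -/
noncomputable def cut (r : S → S → Prop) (s : S) : ℝ≥0 :=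
  sSup {v : ℝ≥0 | ∃ q : ℚ≥0, v = q ∧ r (algebraMap ℚ≥0 S q) s}

theorem cast_le_of_le (h : IsBoundedSemiringPreorder r) {p q : ℚ≥0} {s : S}
    (h₁ : r (algebraMap ℚ≥0 S p) s) (h₂ : r s (algebraMap ℚ≥0 S q)) : (p : ℝ≥0) ≤ q :=
  NNRat.cast_le.2 (h.le_of_algebraMap (h.trans h₁ h₂))

theorem exists_le_algebraMap (h : IsBoundedSemiringPreorder r) (s : S) :
    ∃ q : ℚ≥0, r s (algebraMap ℚ≥0 S q) := by
  obtain ⟨n, hn⟩ := h.le_nat s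
  exact ⟨n, by simpa using hn⟩

theorem le_cut (h : IsBoundedSemiringPreorder r) {q : ℚ≥0} {s : S}
    (hq : r (algebraMap ℚ≥0 S q) s) : (q : ℝ≥0) ≤ cut r s := by
  obtain ⟨b, hb⟩ := h.exists_le_algebraMap s
  refine le_csSup ⟨b, ?_⟩ ⟨q, rfl, hq⟩
  rintro _ ⟨p, rfl, hp⟩
  exact h.cast_le_of_le hp hb

theorem cut_le (h : IsBoundedSemiringPreorder r) {q : ℚ≥0} {s : S}
    (hq : r s (algebraMap ℚ≥0 S q)) : cut r s ≤ q := by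
  refine csSup_le ⟨0, 0, by simp, by simpa using h.nonneg s⟩ ?_
  rintro _ ⟨p, rfl, hp⟩
  exact h.cast_le_of_le hp hq

theorem exists_seq_le (h : IsBoundedSemiringPreorder r) (s : S) :
    ∃ a : ℕ → ℚ≥0, (∀ n, r (algebraMap ℚ≥0 S (a n)) s) ∧
      Tendsto (fun n => (a n : ℝ≥0)) atTop (𝓝 (cut r s)) := by
  obtain ⟨b, hb⟩ := h.exists_le_algebraMap s
  obtain ⟨v, -, hv, hmem⟩ := exists_seq_tendsto_sSup
    (S := {v : ℝ≥0 | ∃ q : ℚ≥0, v = q ∧ r (algebraMap ℚ≥0 S q) s})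
    ⟨0, 0, by simp, by simpa using h.nonneg s⟩
    ⟨b, by rintro _ ⟨p, rfl, hp⟩; exact h.cast_le_of_le hp hb⟩
  choose a ha hr using hmem
  refine ⟨a, hr, ?_⟩
  simp only [← ha]
  exact hv

/-- Totality enters here: a rational above the cut is not below `s`, hence is above it. Two-sided
approximation then makes `cut` additive and multiplicative. -/
theorem exists_seq_ge (h : IsBoundedSemiringPreorder r) (htot : ∀ s t, r s t ∨ r t s) (s : S) :
    ∃ a : ℕ → ℚ≥0, (∀ n, r s (algebraMap ℚ≥0 S (a n))) ∧
      Tendsto (fun n => (a n : ℝ≥0)) atTop (𝓝 (cut r s)) := by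
  have key : ∀ n : ℕ, ∃ q : ℚ≥0, cut r s < q ∧ (q : ℝ≥0) < cut r s + 1 / (n + 1) := fun n => by
    obtain ⟨q, hq₁, hq₂⟩ := NNReal.lt_iff_exists_rat_btwn _ _ |>.1
      (lt_add_of_pos_right (cut r s) (Nat.one_div_pos_of_nat (α := ℝ≥0) (n := n)))
    lift q to ℚ≥0 using hq₁
    have hq : Real.toNNReal ((q : ℚ) : ℝ) = (q : ℝ≥0) := by
      rw [Rat.cast_nnratCast]
      exact NNReal.coe_injective (Real.coe_toNNReal _ (NNRat.cast_nonneg q))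
    rw [hq] at hq₂
    exact ⟨q, hq₂⟩
  choose a ha₁ ha₂ using key
  refine ⟨a, fun n => ?_, ?_⟩
  · refine (htot _ _).resolve_right fun hn => ?_
    exact absurd (h.le_cut hn) (not_le.2 (ha₁ n))
  · refine tendsto_of_tendsto_of_tendsto_of_le_of_le tendsto_const_nhds ?_
      (fun n => (ha₁ n).le) (fun n => (ha₂ n).le)
    simpa using tendsto_const_nhds.add
      (tendsto_one_div_add_atTop_nhds_zero_nat (𝕜 := ℝ≥0))

theorem cut_eq (h : IsBoundedSemiringPreorder r) (q : ℚ≥0) :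
    cut r (algebraMap ℚ≥0 S q) = q :=
  le_antisymm (h.cut_le (h.refl _)) (h.le_cut (h.refl _))

theorem cut_mono (h : IsBoundedSemiringPreorder r) {s t : S} (hst : r s t) :
    cut r s ≤ cut r t := by
  obtain ⟨a, ha, ha'⟩ := h.exists_seq_le s
  exact le_of_tendsto' ha' fun n => h.le_cut (h.trans (ha n) hst)

theorem cut_add (h : IsBoundedSemiringPreorder r) (htot : ∀ s t, r s t ∨ r t s) (s t : S) :
    cut r (s + t) = cut r s + cut r t := by
  obtain ⟨a, ha, ha'⟩ := h.exists_seq_le s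
  obtain ⟨b, hb, hb'⟩ := h.exists_seq_le t
  obtain ⟨c, hc, hc'⟩ := h.exists_seq_ge htot s
  obtain ⟨d, hd, hd'⟩ := h.exists_seq_ge htot t
  refine le_antisymm (ge_of_tendsto' (hc'.add hd') fun n => ?_)
    (le_of_tendsto' (ha'.add hb') fun n => ?_)
  · rw [← NNRat.cast_add]
    exact h.cut_le (by simpa using h.add_add (hc n) (hd n))
  · rw [← NNRat.cast_add]
    exact h.le_cut (by simpa using h.add_add (ha n) (hb n))

theorem cut_mul (h : IsBoundedSemiringPreorder r) (htot : ∀ s t, r s t ∨ r t s) (s t : S) :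
    cut r (s * t) = cut r s * cut r t := by
  obtain ⟨a, ha, ha'⟩ := h.exists_seq_le s
  obtain ⟨b, hb, hb'⟩ := h.exists_seq_le t
  obtain ⟨c, hc, hc'⟩ := h.exists_seq_ge htot s
  obtain ⟨d, hd, hd'⟩ := h.exists_seq_ge htot t
  refine le_antisymm (ge_of_tendsto' (hc'.mul hd') fun n => ?_)
    (le_of_tendsto' (ha'.mul hb') fun n => ?_)
  · rw [← NNRat.cast_mul]
    exact h.cut_le (by simpa using h.mul_mul (hc n) (hd n))
  · rw [← NNRat.cast_mul]
    exact h.le_cut (by simpa using h.mul_mul (ha n) (hb n))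

/-- The homomorphism to `ℝ≥0` defined by a total bounded semiring preorder. -/
noncomputable def cutHom (h : IsBoundedSemiringPreorder r) (htot : ∀ s t, r s t ∨ r t s) :
    S →+* ℝ≥0 where
  toFun := cut r
  map_one' := by simpa using h.cut_eq 1
  map_mul' := h.cut_mul htot
  map_zero' := by simpa using h.cut_eq 0
  map_add' := h.cut_add htot

/-- In a cancellative bounded preordered semiring, failure of `x ≤ y` is witnessed by a monotone
homomorphism, up to equality. -/
theorem exists_hom [NoZeroDivisors S] [Nontrivial S] (h : IsBoundedSemiringPreorder r)
    (hc : Cancellative r) {x y : S} (hxy : ¬ r x y) :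
    ∃ φ : S →+* ℝ≥0, (∀ s t, r s t → φ s ≤ φ t) ∧ φ y ≤ φ x := by
  obtain ⟨m, hrm, hm, htot⟩ := (h.adjoin hc hxy).exists_total
  refine ⟨hm.cutHom htot, fun s t hst => hm.cut_mono (hrm _ _ ⟨0, by simpa using hst⟩),
    hm.cut_mono (hrm _ _ ⟨1, ?_⟩)⟩
  rw [add_comm]
  simpa using h.refl _

end Eval

end IsBoundedSemiringPreorder

/-! ### Polynomial evaluation and real estimates -/

theorem map_aeval_nnrat {S T : Type*} [CommSemiring S] [CommSemiring T] [Algebra ℚ≥0 S]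
    [Algebra ℚ≥0 T] (ψ : S →+* T) (u : S) (p : ℚ≥0[X]) : ψ (aeval u p) = aeval (ψ u) p := by
  rw [aeval_def, aeval_def, hom_eval₂]
  congr 1
  exact Subsingleton.elim _ _

theorem coe_map_aeval {S : Type*} [CommSemiring S] [Algebra ℚ≥0 S] (φ : S →+* ℝ≥0) (u : S) (p : ℚ≥0[X]) :
    (φ (aeval u p) : ℝ) = aeval (φ u : ℝ) p :=
  map_aeval_nnrat (NNReal.toRealHom.comp φ) u p

theorem exists_pos_mul_le (c : ℝ) {δ : ℝ} (hδ : 0 < δ) :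
    ∃ η : ℝ, 0 < η ∧ η * c ≤ δ := by
  refine ⟨δ / (|c| + 1), by positivity, ?_⟩
  rw [div_mul_eq_mul_div, div_le_iff₀ (by positivity)]
  nlinarith [le_abs_self c]

theorem exists_mul_pow_le {α β : ℝ} (hα : 0 < α) (hαβ : α < β) (c : ℝ) :
    ∃ n : ℕ, 0 < n ∧ c * α ^ n ≤ β ^ n := by
  obtain ⟨n, hn⟩ := pow_unbounded_of_one_lt c ((one_lt_div hα).2 hαβ)
  refine ⟨n + 1, n.succ_pos, ?_⟩
  rw [← le_div_iff₀ (by positivity), ← div_pow]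
  exact hn.le.trans (pow_le_pow_right₀ ((one_lt_div hα).2 hαβ).le n.le_succ)

/-- The catalytic relaxation of the preorder of `S` by polynomials in `u` with small value
at `ρ`. -/
def Relaxed {S : Type*} [CommSemiring S] [Preorder S] [Algebra ℚ≥0 S] (u : S) (ρ : ℝ) (s t : S) : Prop :=
  ∀ δ : ℝ, 0 < δ → ∃ (p : ℚ≥0[X]) (a : S), a ≠ 0 ∧ aeval ρ p ≤ δ ∧
    a * s ≤ a * (t + aeval u p)

theorem Relaxed.of_le {S : Type*} [CommSemiring S] [Preorder S] [Algebra ℚ≥0 S]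
    [Nontrivial S] {u : S} {ρ : ℝ} {s t : S} (h : s ≤ t) :
    Relaxed u ρ s t := fun δ hδ => ⟨0, 1, one_ne_zero, by simpa using hδ.le, by simpa using h⟩

/-! ### Power universal elements and catalysts -/

section PowerUniversal

variable {S : Type*} [CommSemiring S] [Preorder S] [IsPreorderedSemiring S]

theorem IsPreorderedSemiring.isOrderedAddMonoid : IsOrderedAddMonoid S where
  add_le_add_left a b h c := by
    rw [add_comm a, add_comm b]
    exact IsPreorderedSemiring.add_le_add c a b h

theorem nonneg_of_zero_le_one (h01 : (0 : S) ≤ 1) (s : S) : 0 ≤ s := by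
  simpa using IsPreorderedSemiring.mul_le_mul s 0 1 h01

theorem le_of_one_le_zero (h01 : (0 : S) ≤ 1) (h10 : (1 : S) ≤ 0) (s t : S) : s ≤ t :=
  le_trans (by simpa using IsPreorderedSemiring.mul_le_mul s 1 0 h10)
    (nonneg_of_zero_le_one h01 t)

theorem not_le_zero_of_ne_zero {u : S} (hu : IsPowerUniversal u) (h01 : (0 : S) ≤ 1)
    (h10 : ¬ (1 : S) ≤ 0) {s : S} (hs : s ≠ 0) : ¬ s ≤ 0 := by
  intro h
  have h1 : (1 : S) ≠ 0 := fun h => h10 h.le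
  obtain ⟨k, hk⟩ := hu.2 s 1 hs h1 (h.trans h01)
  exact h10 (hk.trans (by simpa using IsPreorderedSemiring.mul_le_mul (u ^ k) _ _ h))

/-- Power universality only concerns comparable pairs; `1 + s` serves as a common upper bound of `1`
and `s`. -/
theorem IsPowerUniversal.exists_le_pow {u : S} (hu : IsPowerUniversal u) (h01 : (0 : S) ≤ 1)
    (h10 : ¬ (1 : S) ≤ 0) (s : S) : ∃ k : ℕ, s ≤ u ^ k := by
  have := IsPreorderedSemiring.isOrderedAddMonoid (S := S)
  have h1s : (1 : S) ≤ 1 + s := le_add_of_nonneg_right (nonneg_of_zero_le_one h01 s)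
  obtain ⟨k, hk⟩ := hu.2 1 (1 + s) (fun h => h10 h.le) (fun h => h10 (h1s.trans h.le)) h1s
  exact ⟨k, (le_add_of_nonneg_left h01).trans (by simpa using hk)⟩

theorem IsPowerUniversal.exists_one_le_pow_mul {u : S} (hu : IsPowerUniversal u)
    (h01 : (0 : S) ≤ 1) (h10 : ¬ (1 : S) ≤ 0) {s : S} (hs : s ≠ 0) :
    ∃ k : ℕ, 1 ≤ u ^ k * s := by
  have := IsPreorderedSemiring.isOrderedAddMonoid (S := S)
  have hs1 : s ≤ 1 + s := le_add_of_nonneg_left h01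
  have h1s : (1 : S) ≤ 1 + s := le_add_of_nonneg_right (nonneg_of_zero_le_one h01 s)
  obtain ⟨k, hk⟩ := hu.2 s (1 + s) hs (fun h => h10 (h1s.trans h.le)) hs1
  exact ⟨k, h1s.trans hk⟩

theorem IsPowerUniversal.noZeroDivisors {u : S} (hu : IsPowerUniversal u)
    (h01 : (0 : S) ≤ 1) (h10 : ¬ (1 : S) ≤ 0) : NoZeroDivisors S where
  eq_zero_or_eq_zero_of_mul_eq_zero {a b} hab := by
    by_contra! h
    obtain ⟨k, hk⟩ := hu.exists_one_le_pow_mul h01 h10 h.1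
    have := IsPreorderedSemiring.mul_le_mul b _ _ hk
    rw [mul_one, mul_left_comm, mul_comm b, hab, mul_zero] at this
    exact not_le_zero_of_ne_zero hu h01 h10 h.2 this

/-- Adding `1` to `c * v` shifts the geometric sum `c` to `c + v ^ (n + 1)`, and `1 ≤ c`. Thus `v`
is catalytically below `1` up to a high power of itself. -/
theorem geom_sum_mul_le (h01 : (0 : S) ≤ 1) (v : S) (n : ℕ) :
    (∑ i ∈ Finset.range (n + 1), v ^ i) * v ≤
      (∑ i ∈ Finset.range (n + 1), v ^ i) * (1 + v ^ (n + 1)) := by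
  have := IsPreorderedSemiring.isOrderedAddMonoid (S := S)
  set c := ∑ i ∈ Finset.range (n + 1), v ^ i with hc
  have h1c : 1 ≤ c := by
    rw [hc, geom_sum_succ]
    exact le_add_of_nonneg_left (nonneg_of_zero_le_one h01 _)
  calc c * v ≤ c * v + 1 := le_add_of_nonneg_right h01
    _ = c + v ^ (n + 1) := by
      rw [hc, mul_comm, ← geom_sum_succ, geom_sum_succ', add_comm]
    _ ≤ c + v ^ (n + 1) * c := by
      simpa using IsPreorderedSemiring.add_le_add c _ _
        (IsPreorderedSemiring.mul_le_mul (v ^ (n + 1)) _ _ h1c)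
    _ = c * (1 + v ^ (n + 1)) := by ring

theorem geom_sum_ne_zero_of_not_le (h01 : (0 : S) ≤ 1) (h10 : ¬ (1 : S) ≤ 0) (v : S) (n : ℕ) :
    (∑ i ∈ Finset.range (n + 1), v ^ i) ≠ 0 := by
  have := IsPreorderedSemiring.isOrderedAddMonoid (S := S)
  intro h
  refine h10 (h ▸ ?_)
  rw [geom_sum_succ]
  exact le_add_of_nonneg_left (nonneg_of_zero_le_one h01 _)

/-- One copy of `a` serves for all `n` exchanges of `x` for `q * y`, so inserting and removing it
costs a power of `u` independent of `n`. -/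
theorem exists_pow_catalyst_free {u : S} (hu : IsPowerUniversal u) (h01 : (0 : S) ≤ 1)
    (h10 : ¬ (1 : S) ≤ 0) {a x y q : S} (ha : a ≠ 0) (h : a * x ≤ q * (a * y)) :
    ∃ k : ℕ, ∀ n : ℕ, x ^ n ≤ u ^ k * q ^ n * y ^ n := by
  obtain ⟨k, hk⟩ := hu.exists_one_le_pow_mul h01 h10 ha
  obtain ⟨l, hl⟩ := hu.exists_le_pow h01 h10 a
  have hn : ∀ n : ℕ, a * x ^ n ≤ q ^ n * y ^ n * a := by
    intro n
    induction n with
    | zero => simp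
    | succ n ih =>
      calc a * x ^ (n + 1) = x * (a * x ^ n) := by ring
        _ ≤ x * (q ^ n * y ^ n * a) := IsPreorderedSemiring.mul_le_mul _ _ _ ih
        _ = q ^ n * y ^ n * (a * x) := by ring
        _ ≤ q ^ n * y ^ n * (q * (a * y)) := IsPreorderedSemiring.mul_le_mul _ _ _ h
        _ = q ^ (n + 1) * y ^ (n + 1) * a := by ring
  refine ⟨k + l, fun n => ?_⟩
  calc x ^ n = x ^ n * 1 := (mul_one _).symm
    _ ≤ x ^ n * (u ^ k * a) := IsPreorderedSemiring.mul_le_mul _ _ _ hk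
    _ = u ^ k * (a * x ^ n) := by ring
    _ ≤ u ^ k * (q ^ n * y ^ n * a) := IsPreorderedSemiring.mul_le_mul _ _ _ (hn n)
    _ = u ^ k * q ^ n * y ^ n * a := by ring
    _ ≤ u ^ k * q ^ n * y ^ n * u ^ l := IsPreorderedSemiring.mul_le_mul _ _ _ hl
    _ = u ^ (k + l) * q ^ n * y ^ n := by ring

/-! ### The relaxed preorder -/

variable [Algebra ℚ≥0 S]

theorem Relaxed.trans [NoZeroDivisors S] {u : S} {ρ : ℝ} {s t v : S} (h₁ : Relaxed u ρ s t)
    (h₂ : Relaxed u ρ t v) : Relaxed u ρ s v := by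
  intro δ hδ
  obtain ⟨p, a, ha, hp, h₁⟩ := h₁ (δ / 2) (half_pos hδ)
  obtain ⟨q, b, hb, hq, h₂⟩ := h₂ (δ / 2) (half_pos hδ)
  refine ⟨p + q, a * b, mul_ne_zero ha hb, by rw [map_add]; linarith, ?_⟩
  calc a * b * s = b * (a * s) := by ring
    _ ≤ b * (a * (t + aeval u p)) := IsPreorderedSemiring.mul_le_mul _ _ _ h₁
    _ = a * b * aeval u p + a * (b * t) := by ring
    _ ≤ a * b * aeval u p + a * (b * (v + aeval u q)) :=
      IsPreorderedSemiring.add_le_add _ _ _ (IsPreorderedSemiring.mul_le_mul _ _ _ h₂)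
    _ = a * b * (v + aeval u (p + q)) := by rw [map_add]; ring

theorem Relaxed.add {u : S} {ρ : ℝ} (b : S) {s t : S} (h : Relaxed u ρ s t) :
    Relaxed u ρ (b + s) (b + t) := by
  intro δ hδ
  obtain ⟨p, a, ha, hp, h⟩ := h δ hδ
  refine ⟨p, a, ha, hp, ?_⟩
  simpa only [mul_add, add_assoc] using IsPreorderedSemiring.add_le_add (a * b) _ _ h

theorem Relaxed.mul {u : S} (hu : IsPowerUniversal u) (h01 : (0 : S) ≤ 1) (h10 : ¬ (1 : S) ≤ 0)
    {ρ : ℝ} (hρ : 0 ≤ ρ) (b : S) {s t : S} (h : Relaxed u ρ s t) :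
    Relaxed u ρ (b * s) (b * t) := by
  intro δ hδ
  obtain ⟨k, hk⟩ := hu.exists_le_pow h01 h10 b
  obtain ⟨η, hη, hle⟩ := exists_pos_mul_le (ρ ^ k) hδ
  obtain ⟨p, a, ha, hp, h⟩ := h η hη
  refine ⟨p * X ^ k, a, ha, ?_, ?_⟩
  · rw [map_mul, map_pow, aeval_X]
    exact (mul_le_mul_of_nonneg_right hp (by positivity)).trans hle
  calc a * (b * s) = b * (a * s) := by ring
    _ ≤ b * (a * (t + aeval u p)) := IsPreorderedSemiring.mul_le_mul _ _ _ h
    _ = a * b * t + a * aeval u p * b := by ring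
    _ ≤ a * b * t + a * aeval u p * u ^ k :=
      IsPreorderedSemiring.add_le_add _ _ _ (IsPreorderedSemiring.mul_le_mul _ _ _ hk)
    _ = a * (b * t + aeval u (p * X ^ k)) := by
      rw [map_mul, map_pow, aeval_X]; ring

/-- Apply `geom_sum_mul_le` to `v = u / R`: the error has value `R * (ρ / R) ^ (n + 1)` at `ρ`,
which tends to `0`. -/
theorem relaxed_natCast (h01 : (0 : S) ≤ 1) (h10 : ¬ (1 : S) ≤ 0) (u : S) {ρ : ℝ}
    (hρ : 0 ≤ ρ) {R : ℕ} (hR : ρ < R) : Relaxed u ρ u R := by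
  intro δ hδ
  have hR0 : (0 : ℝ) < R := hρ.trans_lt hR
  have hRq : (R : ℚ≥0) ≠ 0 := by
    rintro h; rw [Nat.cast_eq_zero] at h; simp [h] at hR0
  obtain ⟨η, hη, hle⟩ := exists_pos_mul_le (R : ℝ) hδ
  obtain ⟨n, hn⟩ := exists_pow_lt_of_lt_one hη ((div_lt_one hR0).2 hR)
  have hn' : (ρ / R) ^ (n + 1) ≤ η :=
    (pow_le_pow_of_le_one (by positivity) ((div_lt_one hR0).2 hR).le n.le_succ).trans hn.le
  set v : S := algebraMap ℚ≥0 S (R : ℚ≥0)⁻¹ * u with hv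
  have hRv : (R : S) * v = u := by
    rw [hv, ← mul_assoc, ← map_natCast (algebraMap ℚ≥0 S), ← map_mul, mul_inv_cancel₀ hRq,
      map_one, one_mul]
  refine ⟨(R : ℚ≥0[X]) * (C (R : ℚ≥0)⁻¹ * X) ^ (n + 1), _,
    geom_sum_ne_zero_of_not_le h01 h10 v n, ?_, ?_⟩
  · simp only [map_mul, map_pow, map_natCast, aeval_X, aeval_C]
    rw [map_inv₀, map_natCast, mul_comm, inv_mul_eq_div]
    exact (mul_le_mul_of_nonneg_right hn' hR0.le).trans hle
  · simp only [map_mul, map_pow, map_natCast, aeval_X, aeval_C]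
    rw [← hv]
    have := IsPreorderedSemiring.mul_le_mul (R : S) _ _ (geom_sum_mul_le h01 v n)
    calc _ = (R : S) * ((∑ i ∈ Finset.range (n + 1), v ^ i) * v) := by
          rw [mul_left_comm, hRv]
      _ ≤ _ := this
      _ = _ := by ring

theorem relaxed_pow [Nontrivial S] [NoZeroDivisors S] {u : S} (hu : IsPowerUniversal u)
    (h01 : (0 : S) ≤ 1) (h10 : ¬ (1 : S) ≤ 0) {ρ : ℝ} (hρ : 0 ≤ ρ) {R : ℕ} (hR : ρ < R) (k : ℕ) :
    Relaxed u ρ (u ^ k) ((R ^ k : ℕ) : S) := by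
  induction k with
  | zero => exact Relaxed.of_le (by simp)
  | succ k ih =>
    have h₁ := Relaxed.mul hu h01 h10 hρ (u ^ k) (relaxed_natCast h01 h10 u hρ hR)
    have h₂ := Relaxed.mul hu h01 h10 hρ (R : S) ih
    rw [pow_succ]
    refine h₁.trans ?_
    rw [mul_comm (u ^ k)]
    convert h₂ using 1
    push_cast; ring

/-- Iteration gives `n * s + e ≤ n * t + e`. Bounding `e` by `u ^ k` and dividing by `n` leaves an
error `u ^ k / n`, as small as desired. -/
theorem Relaxed.of_add_right [Nontrivial S] [NoZeroDivisors S] {u : S} (hu : IsPowerUniversal u)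
    (h01 : (0 : S) ≤ 1) (h10 : ¬ (1 : S) ≤ 0) {ρ : ℝ} (hρ : 0 ≤ ρ) {s t e : S}
    (h : Relaxed u ρ (s + e) (t + e)) : Relaxed u ρ s t := by
  have := IsPreorderedSemiring.isOrderedAddMonoid (S := S)
  have hn : ∀ n : ℕ, Relaxed u ρ (n * s + e) (n * t + e) := by
    intro n
    induction n with
    | zero => exact Relaxed.of_le (by simp)
    | succ n ih =>
      have h₁ := ih.add s
      have h₂ := h.add (n * t)
      refine Relaxed.trans (t := s + (n * t + e)) ?_ ?_
      · convert h₁ using 1; push_cast; ring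
      · convert h₂ using 1 <;> push_cast <;> ring
  intro δ hδ
  obtain ⟨k, hk⟩ := hu.exists_le_pow h01 h10 e
  obtain ⟨η, hη, hle⟩ := exists_pos_mul_le (ρ ^ k) (half_pos hδ)
  obtain ⟨n, hnη⟩ := exists_nat_one_div_lt hη
  have hle' : Relaxed u ρ ((n + 1 : ℕ) * s) ((n + 1 : ℕ) * t + u ^ k) :=
    (Relaxed.of_le (le_add_of_nonneg_right (nonneg_of_zero_le_one h01 e))).trans
      ((hn (n + 1)).trans (Relaxed.of_le (IsPreorderedSemiring.add_le_add _ _ _ hk)))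
  have hinv : algebraMap ℚ≥0 S ((n + 1 : ℕ) : ℚ≥0)⁻¹ * ((n + 1 : ℕ) : S) = 1 := by
    rw [← map_natCast (algebraMap ℚ≥0 S), ← map_mul,
      inv_mul_cancel₀ (Nat.cast_ne_zero.2 n.succ_ne_zero), map_one]
  have h' := Relaxed.mul hu h01 h10 hρ (algebraMap ℚ≥0 S ((n + 1 : ℕ) : ℚ≥0)⁻¹) hle'
  rw [← mul_assoc, mul_add, ← mul_assoc, hinv, one_mul, one_mul] at h'
  obtain ⟨p, a, ha, hp, h''⟩ := h' (δ / 2) (half_pos hδ)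
  refine ⟨C ((n + 1 : ℕ) : ℚ≥0)⁻¹ * X ^ k + p, a, ha, ?_, ?_⟩
  · simp only [map_add, map_mul, map_pow, aeval_X, aeval_C]
    rw [map_inv₀, map_natCast]
    have : ((n + 1 : ℕ) : ℝ)⁻¹ * ρ ^ k ≤ η * ρ ^ k := by
      refine mul_le_mul_of_nonneg_right ?_ (by positivity)
      rw [← one_div]; push_cast; exact hnη.le
    linarith
  · simpa only [map_add, map_mul, map_pow, aeval_X, aeval_C, add_assoc] using h''

/-- Once `e` is cancelled, `c` joins the catalyst; `1 ≤ u ^ k * c` lets it be factored out of the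
error too. -/
theorem relaxed_cancellative [Nontrivial S] [NoZeroDivisors S] {u : S} (hu : IsPowerUniversal u)
    (h01 : (0 : S) ≤ 1) (h10 : ¬ (1 : S) ≤ 0) {ρ : ℝ} (hρ : 0 ≤ ρ) :
    IsBoundedSemiringPreorder.Cancellative (Relaxed u ρ) := by
  intro c e s t hc h δ hδ
  obtain ⟨k, hk⟩ := hu.exists_one_le_pow_mul h01 h10 hc
  obtain ⟨η, hη, hle⟩ := exists_pos_mul_le (ρ ^ k) hδ
  obtain ⟨p, a, ha, hp, h⟩ := Relaxed.of_add_right hu h01 h10 hρ h η hη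
  refine ⟨p * X ^ k, a * c, mul_ne_zero ha hc, ?_, ?_⟩
  · rw [map_mul, map_pow, aeval_X]
    exact (mul_le_mul_of_nonneg_right hp (by positivity)).trans hle
  calc a * c * s = a * (c * s) := by ring
    _ ≤ a * (c * t + aeval u p) := h
    _ = a * c * t + a * aeval u p * 1 := by ring
    _ ≤ a * c * t + a * aeval u p * (u ^ k * c) :=
      IsPreorderedSemiring.add_le_add _ _ _ (IsPreorderedSemiring.mul_le_mul _ _ _ hk)
    _ = a * c * (t + aeval u (p * X ^ k)) := by
      rw [map_mul, map_pow, aeval_X]; ring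

theorem relaxed_isBoundedSemiringPreorder [Nontrivial S] [NoZeroDivisors S] {u : S}
    (hu : IsPowerUniversal u) (h01 : (0 : S) ≤ 1) (h10 : ¬ (1 : S) ≤ 0) {ρ : ℝ} (hρ : 0 ≤ ρ)
    {x y : S} (hxy : ¬ Relaxed u ρ x y) : IsBoundedSemiringPreorder (Relaxed u ρ) := by
  obtain ⟨R, hR⟩ := exists_nat_gt ρ
  have hbdd : ∀ s, ∃ n : ℕ, Relaxed u ρ s n := fun s => by
    obtain ⟨k, hk⟩ := hu.exists_le_pow h01 h10 s
    exact ⟨R ^ k, (Relaxed.of_le hk).trans (relaxed_pow hu h01 h10 hρ hR k)⟩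
  refine ⟨fun s => Relaxed.of_le le_rfl, Relaxed.trans, Relaxed.add,
    Relaxed.mul hu h01 h10 hρ, fun s => Relaxed.of_le (nonneg_of_zero_le_one h01 s), hbdd,
    fun s hs => ?_, fun c hc => hxy ?_⟩
  · obtain ⟨k, hk⟩ := hu.exists_one_le_pow_mul h01 h10 hs
    refine ⟨R ^ k, (Relaxed.of_le hk).trans ?_⟩
    rw [mul_comm, mul_comm _ s]
    exact Relaxed.mul hu h01 h10 hρ s (relaxed_pow hu h01 h10 hρ hR k)
  -- If `c + 1 ≤ c`, cancellation gives `1 ≤ 0`, hence `x ≤ 0 ≤ y`, against `hxy`.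
  · have h : Relaxed u ρ 1 0 :=
      Relaxed.of_add_right hu h01 h10 hρ (e := c) (by rwa [add_comm, zero_add])
    have hx := Relaxed.mul hu h01 h10 hρ x h
    rw [mul_one, mul_zero] at hx
    exact hx.trans (Relaxed.of_le (nonneg_of_zero_le_one h01 y))

theorem relaxed_of_forall_hom [Nontrivial S] [NoZeroDivisors S] {u : S}
    (hu : IsPowerUniversal u) (h01 : (0 : S) ≤ 1) (h10 : ¬ (1 : S) ≤ 0) {ρ : ℝ} (hρ : 0 ≤ ρ)
    {x y : S} (h : ∀ φ : S →+* ℝ≥0, Monotone φ → φ x ≤ φ y) : Relaxed u ρ x y := by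
  intro ε hε
  obtain ⟨n, hn⟩ := exists_nat_one_div_lt (half_pos hε)
  set d : ℚ≥0 := ((n + 1 : ℕ) : ℚ≥0)⁻¹ with hd
  have hd0 : 0 < d := by positivity
  -- `exists_hom` yields only a weak inequality; the slack `d` makes it contradictory and is later
  -- absorbed as a constant term.
  have hlt : Relaxed u ρ x (y + algebraMap ℚ≥0 S d) := by
    by_contra hxy
    obtain ⟨φ, hφ, hle⟩ := (relaxed_isBoundedSemiringPreorder hu h01 h10 hρ hxy).exists_hom
      (relaxed_cancellative hu h01 h10 hρ) hxy
    have hφd : φ (algebraMap ℚ≥0 S d) = d := by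
      have : φ.comp (algebraMap ℚ≥0 S) = algebraMap ℚ≥0 ℝ≥0 := Subsingleton.elim _ _
      exact congrArg (fun f : ℚ≥0 →+* ℝ≥0 => f d) this
    have hxy' := h φ fun s t hst => hφ s t (Relaxed.of_le hst)
    rw [map_add, hφd] at hle
    have : (0 : ℝ≥0) < d := NNRat.cast_pos.2 hd0
    exact absurd (hle.trans hxy') (not_le.2 (lt_add_of_pos_right _ this))
  obtain ⟨p, a, ha, hp, hle⟩ := hlt (ε / 2) (half_pos hε)
  refine ⟨C d + p, a, ha, ?_, ?_⟩
  · rw [map_add, aeval_C, hd, map_inv₀, map_natCast, ← one_div]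
    push_cast
    linarith
  · rwa [map_add, aeval_C, ← add_assoc]

end PowerUniversal

/-! ### The equivalence -/

theorem mainTheorem11 {S : Type*} [CommSemiring S] [Preorder S] [IsPreorderedSemiring S]
    [Algebra ℚ≥0 S] (u : S) (hu : IsPowerUniversal u) (h01 : (0 : S) ≤ 1)
    (x y : S) (hx : x ≠ 0) (hy : y ≠ 0) :
    List.TFAE
      [ ∀ φ : S →+* ℝ≥0, Monotone φ → φ x ≤ φ y,
        ∀ r : ℝ, 0 ≤ r → ∀ ε : ℝ, 0 < ε →
          ∃ (p : ℚ≥0[X]) (a : S), a ≠ 0 ∧ aeval r p ≤ ε ∧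
            a * x ≤ a * (y + aeval u p),
        ∀ r : ℝ, 0 ≤ r → ∀ ε : ℝ, 0 < ε →
          ∃ (p : ℚ≥0[X]) (a : S), a ≠ 0 ∧ aeval r p ≤ 1 + ε ∧
            a * x ≤ aeval u p * (a * y),
        ∀ r : ℝ, 0 ≤ r → ∀ ε : ℝ, 0 < ε →
          ∃ (p : ℚ≥0[X]) (n : ℕ), 0 < n ∧ aeval r p ≤ (1 + ε) ^ n ∧
            x ^ n ≤ aeval u p * y ^ n ] := by
  have := nontrivial_of_ne x 0 hx
  by_cases h10 : (1 : S) ≤ 0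
  · have hle : ∀ s t : S, s ≤ t := le_of_one_le_zero h01 h10
    have h₁ : ∀ φ : S →+* ℝ≥0, Monotone φ → φ x ≤ φ y := fun φ hφ => hφ (hle x y)
    have h₂ : ∀ r : ℝ, 0 ≤ r → ∀ ε : ℝ, 0 < ε → ∃ (p : ℚ≥0[X]) (a : S), a ≠ 0 ∧
        aeval r p ≤ ε ∧ a * x ≤ a * (y + aeval u p) := fun r _ ε hε =>
      ⟨0, 1, one_ne_zero, by simpa using hε.le, hle _ _⟩
    have h₃ : ∀ r : ℝ, 0 ≤ r → ∀ ε : ℝ, 0 < ε → ∃ (p : ℚ≥0[X]) (a : S), a ≠ 0 ∧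
        aeval r p ≤ 1 + ε ∧ a * x ≤ aeval u p * (a * y) := fun r _ ε hε =>
      ⟨0, 1, one_ne_zero, by rw [map_zero]; positivity, hle _ _⟩
    have h₄ : ∀ r : ℝ, 0 ≤ r → ∀ ε : ℝ, 0 < ε → ∃ (p : ℚ≥0[X]) (n : ℕ), 0 < n ∧
        aeval r p ≤ (1 + ε) ^ n ∧ x ^ n ≤ aeval u p * y ^ n := fun r _ ε hε =>
      ⟨0, 1, one_pos, by rw [map_zero]; positivity, hle _ _⟩
    tfae_have 1 → 2 := fun _ => h₂
    tfae_have 2 → 3 := fun _ => h₃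
    tfae_have 3 → 4 := fun _ => h₄
    tfae_have 4 → 1 := fun _ => h₁
    tfae_finish
  have := hu.noZeroDivisors h01 h10
  tfae_have 1 → 2 := fun h r hr => relaxed_of_forall_hom hu h01 h10 hr h
  tfae_have 2 → 3 := by
    intro h r hr ε hε
    obtain ⟨k, hk⟩ := hu.exists_one_le_pow_mul h01 h10 hy
    obtain ⟨η, hη, hle⟩ := exists_pos_mul_le (r ^ k) hε
    obtain ⟨p, a, ha, hp, h⟩ := h r hr η hη
    refine ⟨1 + p * X ^ k, a, ha, ?_, ?_⟩
    · rw [map_add, map_one, map_mul, map_pow, aeval_X]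
      have := mul_le_mul_of_nonneg_right hp (pow_nonneg hr k)
      linarith
    calc a * x ≤ a * (y + aeval u p) := h
      _ = a * y + a * aeval u p * 1 := by ring
      _ ≤ a * y + a * aeval u p * (u ^ k * y) :=
        IsPreorderedSemiring.add_le_add _ _ _ (IsPreorderedSemiring.mul_le_mul _ _ _ hk)
      _ = aeval u (1 + p * X ^ k) * (a * y) := by
        rw [map_add, map_one, map_mul, map_pow, aeval_X]; ring
  tfae_have 3 → 4 := by
    intro h r hr ε hε
    obtain ⟨p, a, ha, hp, h⟩ := h r hr (ε / 2) (half_pos hε)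
    obtain ⟨k, hk⟩ := exists_pow_catalyst_free hu h01 h10 ha h
    -- Working with `ε / 2` leaves exponential room to absorb the fixed cost `r ^ k` of the
    -- catalyst.
    obtain ⟨n, hn, hle⟩ := exists_mul_pow_le (α := 1 + ε / 2) (β := 1 + ε) (by positivity)
      (by linarith) (r ^ k)
    refine ⟨X ^ k * p ^ n, n, hn, ?_, by simpa using hk n⟩
    have hp0 : 0 ≤ aeval r p :=
      (NNReal.coe_nonneg _).trans_eq (coe_map_aeval (RingHom.id ℝ≥0) ⟨r, hr⟩ p)
    rw [map_mul, map_pow, map_pow, aeval_X]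
    exact (mul_le_mul_of_nonneg_left (pow_le_pow_left₀ hp0 hp n) (pow_nonneg hr k)).trans hle
  tfae_have 4 → 1 := by
    intro h φ hφ
    rw [← NNReal.coe_le_coe]
    have key : ∀ ε : ℝ, 0 < ε → (φ x : ℝ) ≤ (1 + ε) * φ y := by
      intro ε hε
      -- Choosing `r = φ u` turns the bound on `p` into a bound on `φ (aeval u p)`.
      obtain ⟨p, n, hn, hp, h⟩ := h (φ u) (φ u).coe_nonneg ε hε
      have h' := NNReal.coe_le_coe.2 (hφ h)
      rw [map_mul, map_pow, map_pow, NNReal.coe_mul, NNReal.coe_pow, NNReal.coe_pow,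
        coe_map_aeval] at h'
      refine le_of_pow_le_pow_left₀ hn.ne' (by positivity) (h'.trans ?_)
      rw [mul_pow]
      exact mul_le_mul_of_nonneg_right hp (by positivity)
    refine le_of_forall_pos_le_add fun δ hδ => ?_
    obtain ⟨η, hη, hle⟩ := exists_pos_mul_le (φ y : ℝ) hδ
    linarith [key η hη]
  tfae_finish
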